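/- Let $R$ be a commutative Noetherian ring of finite Krull dimension and let $M$ be a finitely generated $R$-module. For a partially ordered set $P$ with the descending chain condition, let $h_P(a)$, for $a\in P$, be the foundation rank, i.e. the least ordinal strictly greater than $h_P(b)$ for all $b<a$ in $P$, and put $\operatorname{len}(P)=\sup_{a\in P}h_P(a)$. The (ordinal) length $\operatorname{len}(M)$ of a Noetherian module $M$ is the length of the set of all submodules of $M$, partially ordered by reverse inclusion. For ordinals $\mathfrak a,\mathfrak b$ write $\mathfrak a\preceq\mathfrak b$ if for every exponent $e$ the coefficient of $\omega^e$ in the Cantor normal form of $\mathfrak a$ is at most the coefficient of $\omega^e$ in the Cantor normal form of $\mathfrak b$. Then for every submodule $N\subseteq M$ we have $\operatorname{len}(N)\preceq\operatorname{len}(M)$. Conversely, for every ordinal $\mathfrak n$ with $\mathfrak n\preceq\operatorname{len}(M)$ there exists a submodule $N\subseteq M$ with $\operatorname{len}(N)=\mathfrak n$. -/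

import Mathlib

universe u v

namespace OrdLength

/-- The height rank on a partial well-order `P`: the foundation rank of the strict order, i.e.
`h(a)` is the least ordinal greater than `h(b)` for all `b < a`. Equivalently, `h(a) ≥ r + 1` iff
`h(b) ≥ r` for some `b < a`, and for a limit `r`, `h(a) ≥ r` iff for all `s < r` there is `b ≤ a`
with `h(b) ≥ s`. -/
noncomputable def heightRank {P : Type v} [PartialOrder P] [WellFoundedLT P] (a : P) :
    Ordinal.{v} :=
  IsWellFounded.rank (fun x y : P => x < y) a

/-- The (ordinal) length of a partial well-order: the supremum of the height ranks. -/
noncomputable def orderLength (P : Type v) [PartialOrder P] [WellFoundedLT P] : Ordinal.{v} :=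
  ⨆ a : P, heightRank a

/-- The (ordinal) length of a Noetherian module: the length of the set of all its submodules,
partially ordered by reverse inclusion. -/
noncomputable def moduleLength (R : Type u) (M : Type v) [CommRing R] [AddCommGroup M] [Module R M]
    [IsNoetherian R M] : Ordinal.{v} :=
  orderLength (Submodule R M)ᵒᵈ

/-- `a` is weaker than `b`: every coefficient of the Cantor normal form (base `ω`) of `a` is at
most the corresponding coefficient of `b`. -/
def Weaker (a b : Ordinal.{v}) : Prop :=
  ∀ e : Ordinal.{v},
    Ordinal.CNF.coeff Ordinal.omega0 a e ≤ Ordinal.CNF.coeff Ordinal.omega0 b e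

end OrdLength

/-!
The whole argument is carried out with ordinals and exact sequences; neither localization nor the
dimension theory of primes enters.

For an exact sequence `0 → N → M → Q → 0` of Noetherian modules, length is semi-additive:
`len Q + len N ≤ len M ≤ len Q ⊕ len N`, with the ordinal sum on the left and the natural
(Hessenberg) sum on the right (`moduleLength_add_le`, `moduleLength_le_naturalAdd`). Moreover every
ordinal up to `len M` is the length of some quotient of `M`.

Since `ω ^ e` is closed under natural sums, `M` has a largest submodule `smallPart R M e` of length
less than `ω ^ e`. If it vanishes, then `ω ^ e` divides `len M`: otherwise the quotient whose length
is the part of `len M` of exponent at least `e` would have a nonzero kernel, hence a kernel of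
length at least `ω ^ e`, against the lower half of semi-additivity. Applied to
`M ⧸ smallPart R M e`, this shows that `len (smallPart R M e)` is the truncation of `len M` below
exponent `e` (`moduleLength_mod_opow`). The coefficient of `ω ^ e` in `len M` is therefore
`len (smallPart R M (e + 1)) / ω ^ e`, which is monotone in `M`; this proves that the length of a
submodule is weaker than that of the module.

For the converse, commutativity is used. If `I` is a product of annihilators of generators of
`smallPart R M e`, then modules annihilated by a power of `I` have length less than `ω ^ e`, and by
the Artin–Rees lemma `I ^ k • M` meets `smallPart R M e` trivially for large `k`. So `I ^ k • M` is
a submodule with the same coefficient of `ω ^ e` as `M` and no nonzero submodule of length below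
`ω ^ e`. Inside it one finds submodules of length `ω ^ e * k` for every `k` up to that coefficient.
An ordinal weaker than `len M` is then realized by induction along its Cantor normal form, as the
length of a direct sum of such submodules.
-/

namespace OrdLength

open Ordinal Order

/-! ### The natural sum of ordinals -/

/-- The natural (Hessenberg) sum, by well-founded recursion: the least ordinal-valued operation that
is strictly monotone in each of its two arguments. -/
noncomputable def naturalAdd (a b : Ordinal.{v}) : Ordinal.{v} :=
  max (⨆ x : Set.Iio a, succ (naturalAdd x.1 b)) (⨆ x : Set.Iio b, succ (naturalAdd a x.1))
termination_by (a, b)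
decreasing_by
  · exact Prod.Lex.left _ _ x.2
  · exact Prod.Lex.right _ x.2

theorem lt_naturalAdd_iff {a b c : Ordinal.{v}} :
    a < naturalAdd b c ↔
      (∃ b' < b, a ≤ naturalAdd b' c) ∨ ∃ c' < c, a ≤ naturalAdd b c' := by
  rw [naturalAdd, lt_max_iff, Ordinal.lt_iSup_iff, Ordinal.lt_iSup_iff]
  simp

theorem naturalAdd_le_iff {a b c : Ordinal.{v}} :
    naturalAdd b c ≤ a ↔
      (∀ b' < b, naturalAdd b' c < a) ∧ ∀ c' < c, naturalAdd b c' < a := by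
  rw [← not_lt, lt_naturalAdd_iff]
  simp only [not_or, not_exists, not_and, not_le]

theorem naturalAdd_lt_naturalAdd_left {b c : Ordinal.{v}} (h : b < c) (a : Ordinal.{v}) :
    naturalAdd a b < naturalAdd a c :=
  lt_naturalAdd_iff.2 (Or.inr ⟨b, h, le_rfl⟩)

theorem naturalAdd_lt_naturalAdd_right {b c : Ordinal.{v}} (h : b < c) (a : Ordinal.{v}) :
    naturalAdd b a < naturalAdd c a :=
  lt_naturalAdd_iff.2 (Or.inl ⟨b, h, le_rfl⟩)

theorem naturalAdd_le_naturalAdd {a b c d : Ordinal.{v}} (h : a ≤ c) (h' : b ≤ d) :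
    naturalAdd a b ≤ naturalAdd c d := by
  have hl : StrictMono (naturalAdd a) := fun x y hxy => naturalAdd_lt_naturalAdd_left hxy a
  have hr : StrictMono (naturalAdd · d) := fun x y hxy => naturalAdd_lt_naturalAdd_right hxy d
  exact (hl.monotone h').trans (hr.monotone h)

theorem naturalAdd_comm (a b : Ordinal.{v}) : naturalAdd a b = naturalAdd b a := by
  rw [naturalAdd, naturalAdd, max_comm]
  congr 1
  · congr 1; ext x; rw [naturalAdd_comm a x.1]
  · congr 1; ext x; rw [naturalAdd_comm x.1 b]
termination_by (a, b)
decreasing_by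
  · exact Prod.Lex.right _ x.2
  · exact Prod.Lex.left _ _ x.2

theorem naturalAdd_assoc_le (a b c : Ordinal.{v}) :
    naturalAdd (naturalAdd a b) c ≤ naturalAdd a (naturalAdd b c) := by
  induction a using WellFoundedLT.induction generalizing b c with
  | ind a iha =>
  induction b using WellFoundedLT.induction generalizing c with
  | ind b ihb =>
  induction c using WellFoundedLT.induction with
  | ind c ihc =>
  rw [naturalAdd_le_iff]
  refine ⟨fun d hd => ?_, fun c' hc => (ihc c' hc).trans_lt
    (naturalAdd_lt_naturalAdd_left (naturalAdd_lt_naturalAdd_left hc _) _)⟩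
  rcases lt_naturalAdd_iff.1 hd with ⟨a', ha, h⟩ | ⟨b', hb, h⟩
  · exact ((naturalAdd_le_naturalAdd h le_rfl).trans (iha a' ha b c)).trans_lt
      (naturalAdd_lt_naturalAdd_right ha _)
  · exact ((naturalAdd_le_naturalAdd h le_rfl).trans (ihb b' hb c)).trans_lt
      (naturalAdd_lt_naturalAdd_left (naturalAdd_lt_naturalAdd_right hb _) _)

theorem naturalAdd_assoc (a b c : Ordinal.{v}) :
    naturalAdd (naturalAdd a b) c = naturalAdd a (naturalAdd b c) := by
  refine (naturalAdd_assoc_le a b c).antisymm ?_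
  have h := naturalAdd_assoc_le c b a
  rwa [naturalAdd_comm (naturalAdd c b), naturalAdd_comm c (naturalAdd b a), naturalAdd_comm c b,
    naturalAdd_comm b a] at h

theorem naturalAdd_right_comm (a b c : Ordinal.{v}) :
    naturalAdd (naturalAdd a b) c = naturalAdd (naturalAdd a c) b := by
  rw [naturalAdd_assoc, naturalAdd_comm b c, naturalAdd_assoc]

theorem le_naturalAdd_left (a b : Ordinal.{v}) : a ≤ naturalAdd a b :=
  StrictMono.le_apply (f := (naturalAdd · b)) fun _ _ h => naturalAdd_lt_naturalAdd_right h b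

theorem add_le_naturalAdd (a b : Ordinal.{v}) : a + b ≤ naturalAdd a b := by
  induction b using WellFoundedLT.induction with
  | ind b ih =>
  rcases eq_or_ne b 0 with rfl | hb
  · simpa using le_naturalAdd_left a 0
  · exact (Ordinal.add_le_iff hb).2 fun d hd =>
      (ih d hd).trans_lt (naturalAdd_lt_naturalAdd_left hd a)

theorem exists_lt_of_lt_opow_mul {e a x : Ordinal.{v}} (h : x < ω ^ e * a) :
    ∃ a' < a, ∃ r < ω ^ e, x = ω ^ e * a' + r := by
  have he : (ω : Ordinal.{v}) ^ e ≠ 0 := (opow_pos e omega0_pos).ne'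
  exact ⟨x / ω ^ e, (Ordinal.lt_mul_iff_div_lt he).1 h, x % ω ^ e, Ordinal.mod_lt x he,
    (Ordinal.div_add_mod x _).symm⟩

theorem naturalAdd_opow_mul_of_isPrincipal {e : Ordinal.{v}}
    (he : IsPrincipal naturalAdd (ω ^ e)) (a : Ordinal.{v}) {b : Ordinal.{v}} (hb : b < ω ^ e) :
    naturalAdd (ω ^ e * a) b = ω ^ e * a + b := by
  refine le_antisymm ?_ (add_le_naturalAdd _ _)
  induction a using WellFoundedLT.induction generalizing b with
  | ind a iha =>
  induction b using WellFoundedLT.induction with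
  | ind b ihb =>
  refine naturalAdd_le_iff.2 ⟨fun x hx => ?_, fun b' hb' =>
    (ihb b' hb' (hb'.trans hb)).trans_lt (add_lt_add_right hb' _)⟩
  obtain ⟨a', ha', r, hr, rfl⟩ := exists_lt_of_lt_opow_mul hx
  refine lt_of_lt_of_le ?_ (le_add_right le_rfl)
  calc naturalAdd (ω ^ e * a' + r) b
      ≤ naturalAdd (ω ^ e * a') (naturalAdd r b) := by
        rw [← naturalAdd_assoc]
        exact naturalAdd_le_naturalAdd (add_le_naturalAdd _ _) le_rfl
    _ ≤ ω ^ e * a' + naturalAdd r b := iha a' ha' (he hr hb)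
    _ < ω ^ e * a := opow_mul_add_lt_opow_mul (he hr hb) ha'

theorem naturalAdd_opow_mul_opow_le_of_isPrincipal {e : Ordinal.{v}}
    (he : IsPrincipal naturalAdd (ω ^ e)) (a : Ordinal.{v}) :
    naturalAdd (ω ^ e * a) (ω ^ e) ≤ ω ^ e * (a + 1) := by
  induction a using WellFoundedLT.induction with
  | ind a iha =>
  refine naturalAdd_le_iff.2 ⟨fun x hx => ?_, fun b hb => ?_⟩
  · obtain ⟨a', ha', r, hr, rfl⟩ := exists_lt_of_lt_opow_mul hx
    have h1 : a' + 1 ≤ a := add_one_le_of_lt ha'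
    calc naturalAdd (ω ^ e * a' + r) (ω ^ e)
        ≤ naturalAdd (naturalAdd (ω ^ e * a') (ω ^ e)) r := by
          rw [naturalAdd_right_comm]
          exact naturalAdd_le_naturalAdd (add_le_naturalAdd _ _) le_rfl
      _ ≤ naturalAdd (ω ^ e * a) r :=
          naturalAdd_le_naturalAdd ((iha a' ha').trans (mul_le_mul_right h1 _)) le_rfl
      _ = ω ^ e * a + r := naturalAdd_opow_mul_of_isPrincipal he a hr
      _ < ω ^ e * (a + 1) := opow_mul_add_lt_opow_mul hr (lt_add_one a)
  · rw [naturalAdd_opow_mul_of_isPrincipal he a hb]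
    exact opow_mul_add_lt_opow_mul hb (lt_add_one a)

theorem naturalAdd_opow_mul_natCast_le_of_isPrincipal {e : Ordinal.{v}}
    (he : IsPrincipal naturalAdd (ω ^ e)) (a : Ordinal.{v}) (n : ℕ) :
    naturalAdd (ω ^ e * a) (ω ^ e * n) ≤ ω ^ e * (a + n) := by
  induction n with
  | zero => simpa using (naturalAdd_opow_mul_of_isPrincipal he a (opow_pos e omega0_pos)).le
  | succ n ih =>
    calc naturalAdd (ω ^ e * a) (ω ^ e * (n + 1 : ℕ))
        ≤ naturalAdd (naturalAdd (ω ^ e * a) (ω ^ e * n)) (ω ^ e) := by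
          rw [naturalAdd_assoc, Nat.cast_succ, mul_add_one]
          exact naturalAdd_le_naturalAdd le_rfl (add_le_naturalAdd _ _)
      _ ≤ naturalAdd (ω ^ e * (a + n)) (ω ^ e) := naturalAdd_le_naturalAdd ih le_rfl
      _ ≤ ω ^ e * (a + (n + 1 : ℕ)) := by
          rw [Nat.cast_succ, ← add_assoc]
          exact naturalAdd_opow_mul_opow_le_of_isPrincipal he _

theorem isPrincipal_naturalAdd_omega0_opow (e : Ordinal.{v}) :
    IsPrincipal naturalAdd (ω ^ e) := by
  induction e using Ordinal.limitRecOn with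
  | zero =>
    intro x y hx hy
    rw [opow_zero, Order.lt_one_iff] at *
    subst hx hy
    exact le_antisymm (naturalAdd_le_iff.2 ⟨fun _ h => (not_lt_zero h).elim,
      fun _ h => (not_lt_zero h).elim⟩) zero_le
  | add_one e ih =>
    intro x y hx hy
    rw [← succ_eq_add_one] at *
    obtain ⟨m, hm⟩ := lt_omega0_opow_succ.1 hx
    obtain ⟨n, hn⟩ := lt_omega0_opow_succ.1 hy
    calc naturalAdd x y ≤ naturalAdd (ω ^ e * m) (ω ^ e * n) :=
          naturalAdd_le_naturalAdd hm.le hn.le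
      _ ≤ ω ^ e * (m + n) := naturalAdd_opow_mul_natCast_le_of_isPrincipal ih m n
      _ < ω ^ e * ω := by
          rw [← Nat.cast_add]
          exact (mul_lt_mul_iff_right₀ (opow_pos e omega0_pos)).2 (natCast_lt_omega0 _)
      _ = ω ^ succ e := (opow_succ ω e).symm
  | limit e he ih =>
    intro x y hx hy
    obtain ⟨c, hc, hxc⟩ := (lt_opow_of_isSuccLimit omega0_ne_zero he).1 hx
    obtain ⟨d, hd, hyd⟩ := (lt_opow_of_isSuccLimit omega0_ne_zero he).1 hy
    have hcd : max c d < e := max_lt hc hd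
    exact (ih _ hcd (hxc.trans_le (opow_le_opow_right omega0_pos (le_max_left c d)))
      (hyd.trans_le (opow_le_opow_right omega0_pos (le_max_right c d)))).trans_le
      (opow_le_opow_right omega0_pos hcd.le)

theorem naturalAdd_lt_omega0_opow {e x y : Ordinal.{v}} (hx : x < ω ^ e) (hy : y < ω ^ e) :
    naturalAdd x y < ω ^ e :=
  isPrincipal_naturalAdd_omega0_opow e hx hy

/-- No absorption occurs when an ordinal below `ω ^ e` is added to a multiple of `ω ^ e`, so the
natural sum is the ordinary one. -/
theorem naturalAdd_opow_mul {e b : Ordinal.{v}} (a : Ordinal.{v}) (hb : b < ω ^ e) :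
    naturalAdd (ω ^ e * a) b = ω ^ e * a + b :=
  naturalAdd_opow_mul_of_isPrincipal (isPrincipal_naturalAdd_omega0_opow e) a hb

theorem naturalAdd_opow_mul_natCast_le (e a : Ordinal.{v}) (n : ℕ) :
    naturalAdd (ω ^ e * a) (ω ^ e * n) ≤ ω ^ e * (a + n) :=
  naturalAdd_opow_mul_natCast_le_of_isPrincipal (isPrincipal_naturalAdd_omega0_opow e) a n

/-! ### Coefficients of the Cantor normal form -/

theorem coeff_eq_mod_div {b : Ordinal.{v}} (hb : 1 < b) (o e : Ordinal.{v}) :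
    CNF.coeff b o e = o % b ^ (e + 1) / b ^ e := by
  have hb0 : b ≠ 0 := (zero_lt_one.trans hb).ne'
  induction o using CNF.rec b with
  | H0 => simp
  | H o ho ih =>
    rcases lt_or_ge (log b o) e with h | h
    · have hoe : o < b ^ e := (lt_opow_iff_log_lt hb ho).2 h
      rw [CNF.coeff_eq_zero_of_lt hoe, Ordinal.div_eq_zero_of_lt]
      exact (mod_le o _).trans_lt hoe
    · have hc := CNF.coeff_opow_mul_add (b := b) (e := log b o) (x := o / b ^ log b o)
        (y := o % b ^ log b o) hb (div_opow_log_pos b ho).ne' (div_opow_log_lt o hb)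
        (mod_lt o (opow_ne_zero _ hb0))
      rw [div_add_mod] at hc
      rw [hc, Finsupp.add_apply]
      rcases h.eq_or_lt with rfl | h
      · rw [Finsupp.single_eq_same, CNF.coeff_eq_zero_of_lt (mod_lt o (opow_ne_zero _ hb0)),
          add_zero, mod_eq_of_lt]
        exact lt_opow_succ_log_self hb o
      · rw [Finsupp.single_eq_of_ne h.ne, zero_add, ih]
        congr 1
        conv_rhs => rw [← div_add_mod o (b ^ log b o)]
        obtain ⟨t, ht⟩ := opow_dvd_opow b (add_one_le_of_lt h)
        rw [ht, mul_assoc, mul_add_mod_self]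

/-! ### Height ranks and the length of a Noetherian module -/

theorem heightRank_strictMono {P : Type v} [PartialOrder P] [WellFoundedLT P] :
    StrictMono (heightRank : P → Ordinal.{v}) :=
  fun _ _ h => IsWellFounded.rank_lt_of_rel h

theorem exists_lt_of_lt_heightRank {P : Type v} [PartialOrder P] [WellFoundedLT P] {a : P}
    {o : Ordinal.{v}} (h : o < heightRank a) : ∃ b < a, o ≤ heightRank b := by
  rw [heightRank, IsWellFounded.rank_eq, Ordinal.lt_iSup_iff] at h
  obtain ⟨b, hb⟩ := h
  exact ⟨b.1, b.2, lt_succ_iff.1 hb⟩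

theorem exists_heightRank_eq {P : Type v} [PartialOrder P] [WellFoundedLT P] {a : P}
    {o : Ordinal.{v}} (h : o ≤ heightRank a) : ∃ b : P, heightRank b = o :=
  IsWellFounded.mem_range_rank_of_le h

/-- The height rank is the least strictly monotone ordinal-valued function. -/
theorem heightRank_le_of_strictMonoOn {P : Type v} [PartialOrder P] [WellFoundedLT P]
    {f : P → Ordinal.{v}} (a : P) (hf : StrictMonoOn f (Set.Iic a)) : heightRank a ≤ f a := by
  induction a using WellFoundedLT.induction with
  | ind a ih =>
  refine le_of_forall_lt fun o ho => ?_
  obtain ⟨b, hb, hob⟩ := exists_lt_of_lt_heightRank ho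
  exact (hob.trans (ih b hb (hf.mono (Set.Iic_subset_Iic.2 hb.le)))).trans_lt
    (hf hb.le le_rfl hb)

theorem orderLength_eq_heightRank_top (P : Type v) [PartialOrder P] [WellFoundedLT P]
    [OrderTop P] : orderLength P = heightRank (⊤ : P) :=
  le_antisymm (Ordinal.iSup_le fun _ => heightRank_strictMono.monotone le_top)
    (Ordinal.le_iSup _ _)

section Module

variable {R : Type u} [CommRing R] {M N Q : Type v}
  [AddCommGroup M] [Module R M] [IsNoetherian R M]
  [AddCommGroup N] [Module R N] [IsNoetherian R N]
  [AddCommGroup Q] [Module R Q] [IsNoetherian R Q]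

/-- The height rank of a submodule in the reverse inclusion order; it equals the length of the
quotient module, see `submoduleRank_eq_moduleLength_quotient`. -/
noncomputable def submoduleRank (H : Submodule R M) : Ordinal.{v} :=
  heightRank (OrderDual.toDual H)

theorem submoduleRank_strictAnti : StrictAnti (submoduleRank : Submodule R M → Ordinal.{v}) :=
  fun _ _ h => heightRank_strictMono (OrderDual.toDual_lt_toDual.2 h)

theorem moduleLength_eq_submoduleRank_bot : moduleLength R M = submoduleRank (⊥ : Submodule R M) :=
  orderLength_eq_heightRank_top _

theorem submoduleRank_le_of_strictAntiOn {f : Submodule R M → Ordinal.{v}} (H : Submodule R M)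
    (hf : StrictAntiOn f (Set.Ici H)) : submoduleRank H ≤ f H :=
  heightRank_le_of_strictMonoOn (f := fun K => f (OrderDual.ofDual K)) (OrderDual.toDual H)
    fun _ ha _ hb hab => hf hb ha hab

theorem exists_gt_of_lt_submoduleRank {H : Submodule R M} {o : Ordinal.{v}}
    (h : o < submoduleRank H) : ∃ K > H, o ≤ submoduleRank K :=
  exists_lt_of_lt_heightRank (P := (Submodule R M)ᵒᵈ) h

theorem moduleLength_le_of_injective (f : N →ₗ[R] M) (hf : Function.Injective f) :
    moduleLength R N ≤ moduleLength R M := by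
  rw [moduleLength_eq_submoduleRank_bot, moduleLength_eq_submoduleRank_bot,
    ← Submodule.map_bot f]
  exact submoduleRank_le_of_strictAntiOn (f := fun K => submoduleRank (K.map f)) _
    fun _ _ _ _ h => submoduleRank_strictAnti (Submodule.map_strictMono_of_injective hf h)

theorem moduleLength_le_submoduleRank_ker (g : M →ₗ[R] Q) (hg : Function.Surjective g) :
    moduleLength R Q ≤ submoduleRank (LinearMap.ker g) := by
  rw [moduleLength_eq_submoduleRank_bot]
  exact submoduleRank_le_of_strictAntiOn (f := fun K => submoduleRank (K.comap g)) _
    fun _ _ _ _ h => submoduleRank_strictAnti (Submodule.comap_strictMono_of_surjective hg h)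

theorem moduleLength_le_of_surjective (g : M →ₗ[R] Q) (hg : Function.Surjective g) :
    moduleLength R Q ≤ moduleLength R M := by
  rw [moduleLength_eq_submoduleRank_bot (M := M)]
  exact (moduleLength_le_submoduleRank_ker g hg).trans
    (submoduleRank_strictAnti.antitone bot_le)

theorem moduleLength_congr (e : M ≃ₗ[R] N) : moduleLength R M = moduleLength R N :=
  le_antisymm (moduleLength_le_of_injective e.toLinearMap e.injective)
    (moduleLength_le_of_surjective e.toLinearMap e.surjective)

theorem submoduleRank_eq_moduleLength_quotient (H : Submodule R M) :
    submoduleRank H = moduleLength R (M ⧸ H) := by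
  apply le_antisymm
  · rw [moduleLength_eq_submoduleRank_bot, ← Submodule.mkQ_map_self H]
    refine submoduleRank_le_of_strictAntiOn (f := fun K => submoduleRank (K.map H.mkQ)) H
      fun A hA B hB h => submoduleRank_strictAnti
        ((Submodule.map_mono h.le).lt_of_not_ge fun hle => h.not_ge ?_)
    have := Submodule.comap_mono (f := H.mkQ) hle
    rwa [Submodule.comap_map_mkQ, Submodule.comap_map_mkQ, sup_eq_right.2 hB,
      sup_eq_right.2 hA] at this
  · simpa using moduleLength_le_submoduleRank_ker H.mkQ H.mkQ_surjective

/-- Every ordinal up to the length of a module is the length of a quotient. -/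
theorem exists_moduleLength_quotient_eq {o : Ordinal.{v}} (h : o ≤ moduleLength R M) :
    ∃ H : Submodule R M, moduleLength R (M ⧸ H) = o := by
  rw [moduleLength_eq_submoduleRank_bot] at h
  obtain ⟨H, hH⟩ := exists_heightRank_eq (P := (Submodule R M)ᵒᵈ) h
  exact ⟨OrderDual.ofDual H, (submoduleRank_eq_moduleLength_quotient _).symm.trans hH⟩

/-- Lower half of semi-additivity: a chain of submodules containing the kernel followed by a
chain inside the kernel is a chain in the middle module. -/
theorem moduleLength_add_le (f : N →ₗ[R] M) (g : M →ₗ[R] Q) (hf : Function.Injective f)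
    (hg : Function.Surjective g) (hfg : LinearMap.range f ≤ LinearMap.ker g) :
    moduleLength R Q + moduleLength R N ≤ moduleLength R M := by
  suffices h : ∀ K : Submodule R N,
      moduleLength R Q + submoduleRank K ≤ submoduleRank (K.map f) by
    have := h ⊥
    rwa [Submodule.map_bot, ← moduleLength_eq_submoduleRank_bot,
      ← moduleLength_eq_submoduleRank_bot] at this
  intro K
  induction K using WellFoundedGT.induction with
  | ind K ih =>
  rcases eq_or_ne (submoduleRank K) 0 with h0 | h0
  · rw [h0, add_zero]
    exact (moduleLength_le_submoduleRank_ker g hg).trans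
      (submoduleRank_strictAnti.antitone (LinearMap.map_le_range.trans hfg))
  · refine (Ordinal.add_le_iff h0).2 fun d hd => ?_
    obtain ⟨K', hK', hd'⟩ := exists_gt_of_lt_submoduleRank hd
    exact ((add_le_add_right hd' _).trans (ih K' hK')).trans_lt
      (submoduleRank_strictAnti (Submodule.map_strictMono_of_injective hf hK'))

/-- Upper half of semi-additivity: by the modular law a submodule of the middle module is
determined, among comparable ones, by its preimage and its image. -/
theorem moduleLength_le_naturalAdd (f : N →ₗ[R] M) (g : M →ₗ[R] Q)
    (hfg : LinearMap.ker g ≤ LinearMap.range f) :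
    moduleLength R M ≤ naturalAdd (moduleLength R Q) (moduleLength R N) := by
  rw [moduleLength_eq_submoduleRank_bot]
  refine (submoduleRank_le_of_strictAntiOn
    (f := fun K => naturalAdd (submoduleRank (K.map g)) (submoduleRank (K.comap f))) ⊥
    fun A _ B _ h => ?_).trans ?_
  · have h1 := Submodule.map_mono (f := g) h.le
    have h2 := Submodule.comap_mono (f := f) h.le
    rcases h1.lt_or_eq with h1 | h1
    · exact (naturalAdd_lt_naturalAdd_right (submoduleRank_strictAnti h1) _).trans_le
        (naturalAdd_le_naturalAdd le_rfl (submoduleRank_strictAnti.antitone h2))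
    · refine (naturalAdd_lt_naturalAdd_left (submoduleRank_strictAnti
        (h2.lt_of_not_ge fun hle => h.not_ge fun x hx => ?_)) _).trans_le
        (naturalAdd_le_naturalAdd (submoduleRank_strictAnti.antitone h1.le) le_rfl)
      obtain ⟨y, hy, hyx⟩ : g x ∈ A.map g := h1 ▸ Submodule.mem_map_of_mem hx
      obtain ⟨z, hz⟩ : x - y ∈ LinearMap.range f := hfg (by simp [hyx])
      have hzA : z ∈ A.comap f := hle (by
        rw [Submodule.mem_comap, hz]
        exact B.sub_mem hx (h.le hy))
      rw [Submodule.mem_comap, hz] at hzA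
      simpa using A.add_mem hzA hy
  · refine naturalAdd_le_naturalAdd ?_ ?_ <;> rw [moduleLength_eq_submoduleRank_bot] <;>
      exact submoduleRank_strictAnti.antitone bot_le

theorem moduleLength_quotient_add_le (H : Submodule R M) :
    moduleLength R (M ⧸ H) + moduleLength R H ≤ moduleLength R M :=
  moduleLength_add_le H.subtype H.mkQ H.injective_subtype H.mkQ_surjective (by simp)

theorem moduleLength_le_naturalAdd_quotient (H : Submodule R M) :
    moduleLength R M ≤ naturalAdd (moduleLength R (M ⧸ H)) (moduleLength R H) :=
  moduleLength_le_naturalAdd H.subtype H.mkQ (by simp)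

theorem moduleLength_mono {H K : Submodule R M} (h : H ≤ K) :
    moduleLength R H ≤ moduleLength R K :=
  moduleLength_le_of_injective (Submodule.inclusion h) (Submodule.inclusion_injective h)

theorem moduleLength_eq_zero_of_subsingleton [Subsingleton M] : moduleLength R M = 0 := by
  rw [moduleLength_eq_submoduleRank_bot]
  by_contra h
  obtain ⟨K, hK, -⟩ := exists_gt_of_lt_submoduleRank (pos_iff_ne_zero.2 h)
  exact hK.ne (Subsingleton.elim _ _)

end Module

theorem moduleLength_map_eq {R : Type u} [CommRing R] {M N : Type v} [AddCommGroup M] [Module R M]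
    [IsNoetherian R M] [AddCommGroup N] [Module R N] (f : M →ₗ[R] N) (hf : Function.Injective f)
    (H : Submodule R M) : moduleLength R (H.map f) = moduleLength R H :=
  (moduleLength_congr (Submodule.equivMapOfInjective f hf H)).symm

/-! ### The largest submodule of length less than a power of `ω` -/

section SmallPart

variable {R : Type u} [CommRing R] {M N Q : Type v}
  [AddCommGroup M] [Module R M] [IsNoetherian R M]
  [AddCommGroup N] [Module R N] [IsNoetherian R N]

theorem moduleLength_lt_opow_of_quotient {e : Ordinal.{v}} (H : Submodule R M)
    (hH : moduleLength R H < ω ^ e) (hQ : moduleLength R (M ⧸ H) < ω ^ e) :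
    moduleLength R M < ω ^ e :=
  (moduleLength_le_naturalAdd_quotient H).trans_lt (naturalAdd_lt_omega0_opow hQ hH)

theorem moduleLength_sup_lt_opow {e : Ordinal.{v}} {H K : Submodule R M}
    (hH : moduleLength R H < ω ^ e) (hK : moduleLength R K < ω ^ e) :
    moduleLength R (H ⊔ K : Submodule R M) < ω ^ e := by
  have hmap : (H ⊔ K).map H.mkQ = K.map H.mkQ := by simp [Submodule.map_sup]
  refine (moduleLength_le_naturalAdd (Submodule.inclusion (le_sup_left : H ≤ H ⊔ K))
    (H.mkQ.submoduleMap (H ⊔ K)) ?_).trans_lt (naturalAdd_lt_omega0_opow ?_ hH)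
  · rintro ⟨x, hx⟩ hxk
    rw [Submodule.range_inclusion]
    simpa [Subtype.ext_iff] using hxk
  · exact (moduleLength_mono hmap.le).trans_lt ((moduleLength_le_of_surjective
      (H.mkQ.submoduleMap K) (H.mkQ.submoduleMap_surjective K)).trans_lt hK)

variable (R M) in
/-- The largest submodule of `M` of length less than `ω ^ e`. -/
noncomputable def smallPart (e : Ordinal.{v}) : Submodule R M :=
  sSup {H | moduleLength R H < ω ^ e}

theorem le_smallPart {e : Ordinal.{v}} {H : Submodule R M} (h : moduleLength R H < ω ^ e) :
    H ≤ smallPart R M e :=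
  le_sSup h

theorem moduleLength_smallPart_lt (e : Ordinal.{v}) :
    moduleLength R (smallPart R M e) < ω ^ e := by
  have hne : {H : Submodule R M | moduleLength R H < ω ^ e}.Nonempty :=
    ⟨⊥, by
      rw [Set.mem_ofPred_eq, moduleLength_eq_zero_of_subsingleton]
      exact opow_pos e omega0_pos⟩
  obtain ⟨H, hH, hmax⟩ := set_has_maximal_iff_noetherian.2 ‹IsNoetherian R M› _ hne
  have : smallPart R M e = H := by
    refine le_antisymm (sSup_le fun K hK => ?_) (le_smallPart hH)
    by_contra hle
    exact hmax _ (moduleLength_sup_lt_opow hH hK) (left_lt_sup.2 hle)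
  rwa [this]

theorem eq_top_of_smallPart {e : Ordinal.{v}} (h : smallPart R M e = ⊤) :
    moduleLength R M < ω ^ e := by
  rw [← moduleLength_congr (Submodule.topEquiv (R := R) (M := M)), ← h]
  exact moduleLength_smallPart_lt e

theorem map_smallPart_le (e : Ordinal.{v}) (f : N →ₗ[R] M) :
    (smallPart R N e).map f ≤ smallPart R M e :=
  le_smallPart ((moduleLength_le_of_surjective (f.submoduleMap _)
    (f.submoduleMap_surjective _)).trans_lt (moduleLength_smallPart_lt e))

theorem smallPart_quotient_smallPart (e : Ordinal.{v}) :
    smallPart R (M ⧸ smallPart R M e) e = ⊥ := by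
  set D := smallPart R M e with hD
  set H := smallPart R (M ⧸ D) e with hH
  have hle : H.comap D.mkQ ≤ D := by
    refine le_smallPart ((moduleLength_le_naturalAdd
      (Submodule.inclusion (Submodule.le_comap_mkQ D H))
      (D.mkQ.restrict (p := H.comap D.mkQ) (q := H) fun x hx => hx) ?_).trans_lt
      (naturalAdd_lt_omega0_opow (moduleLength_smallPart_lt e) (moduleLength_smallPart_lt e)))
    rintro ⟨x, hx⟩ hxk
    rw [Submodule.range_inclusion]
    simpa [Subtype.ext_iff] using hxk
  rw [eq_bot_iff, ← Submodule.map_comap_eq_of_surjective D.mkQ_surjective H]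
  exact (Submodule.map_mono hle).trans (by simp)

/-- If every nonzero submodule has length at least `ω ^ e`, the length has no terms of exponent
below `e`: a quotient realizing the part of exponent at least `e` would otherwise have a kernel
too long for semi-additivity. -/
theorem opow_dvd_moduleLength {e : Ordinal.{v}} (h : smallPart R M e = ⊥) :
    ω ^ e ∣ moduleLength R M := by
  set l := moduleLength R M with hl
  have hpos : (ω : Ordinal.{v}) ^ e ≠ 0 := (opow_pos e omega0_pos).ne'
  obtain ⟨H, hH⟩ := exists_moduleLength_quotient_eq (R := R) (M := M) (Ordinal.mul_div_le l (ω ^ e))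
  have hadd := moduleLength_quotient_add_le H
  rw [hH, ← hl] at hadd
  have hHsmall : moduleLength R H < ω ^ e := by
    by_contra! hge
    refine ((add_le_add_right hge _).trans hadd).not_gt ?_
    conv_lhs => rw [← Ordinal.div_add_mod l (ω ^ e)]
    exact add_lt_add_right (mod_lt l hpos) _
  obtain rfl : H = ⊥ := le_bot_iff.1 (h ▸ le_smallPart hHsmall)
  rw [moduleLength_congr (Submodule.quotEquivOfEqBot _ rfl)] at hH
  exact ⟨_, hH⟩

/-- Truncating the Cantor normal form of the length below exponent `e` gives the length of the
largest submodule of length less than `ω ^ e`. -/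
theorem moduleLength_mod_opow (e : Ordinal.{v}) :
    moduleLength R M % ω ^ e = moduleLength R (smallPart R M e) := by
  obtain ⟨a, ha⟩ := opow_dvd_moduleLength (smallPart_quotient_smallPart (R := R) (M := M) e)
  have h1 := moduleLength_quotient_add_le (smallPart R M e)
  have h2 := moduleLength_le_naturalAdd_quotient (smallPart R M e)
  rw [ha] at h1 h2
  rw [naturalAdd_opow_mul a (moduleLength_smallPart_lt e)] at h2
  rw [h2.antisymm h1, mul_add_mod_self, mod_eq_of_lt (moduleLength_smallPart_lt e)]

theorem coeff_moduleLength (e : Ordinal.{v}) :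
    CNF.coeff ω (moduleLength R M) e = moduleLength R (smallPart R M (e + 1)) / ω ^ e := by
  rw [coeff_eq_mod_div one_lt_omega0, moduleLength_mod_opow]

theorem weaker_moduleLength_of_injective (f : N →ₗ[R] M) (hf : Function.Injective f) :
    Weaker (moduleLength R N) (moduleLength R M) := by
  intro e
  rw [coeff_moduleLength, coeff_moduleLength, ← moduleLength_map_eq f hf]
  exact Ordinal.div_le_left (moduleLength_mono (map_smallPart_le (e + 1) f)) _

end SmallPart

/-! ### Submodules splitting off the small part -/

section Annihilator

variable {R : Type u} [CommRing R]

/-- The ideal `I` forces every Noetherian module (in the universe `v`) annihilated by `I` to have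
length less than `ω ^ e`. -/
def BoundsLength (e : Ordinal.{v}) (I : Ideal R) : Prop :=
  ∀ (Q : Type v) [AddCommGroup Q] [Module R Q] [IsNoetherian R Q],
    (∀ r ∈ I, ∀ q : Q, r • q = 0) → moduleLength R Q < ω ^ e

theorem boundsLength_top (e : Ordinal.{v}) : BoundsLength e (⊤ : Ideal R) := by
  intro Q _ _ _ h
  have : Subsingleton Q := ⟨fun a b => by
    rw [← one_smul R a, ← one_smul R b, h 1 trivial, h 1 trivial]⟩
  rw [moduleLength_eq_zero_of_subsingleton]
  exact opow_pos e omega0_pos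

theorem BoundsLength.mul {e : Ordinal.{v}} {I J : Ideal R} (hI : BoundsLength e I)
    (hJ : BoundsLength e J) : BoundsLength e (I * J) := by
  intro Q _ _ _ h
  refine moduleLength_lt_opow_of_quotient (J • ⊤ : Submodule R Q) (hI _ ?_) (hJ _ ?_)
  · rintro r hr ⟨q, hq⟩
    rw [Subtype.ext_iff]
    change r • q = 0
    induction hq using Submodule.smul_induction_on' with
    | smul s hs x _ => rw [smul_smul]; exact h _ (Ideal.mul_mem_mul hr hs) x
    | add x _ y _ hx hy => rw [smul_add, hx, hy, add_zero]
  · intro r hr q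
    obtain ⟨q, rfl⟩ := Submodule.mkQ_surjective _ q
    rw [← map_smul, Submodule.mkQ_apply, Submodule.Quotient.mk_eq_zero]
    exact Submodule.smul_mem_smul hr trivial

theorem BoundsLength.pow {e : Ordinal.{v}} {I : Ideal R} (hI : BoundsLength e I) (n : ℕ) :
    BoundsLength e (I ^ n) := by
  induction n with
  | zero => simpa using boundsLength_top e
  | succ n ih => exact pow_succ I n ▸ ih.mul hI

variable {M : Type v} [AddCommGroup M] [Module R M] [IsNoetherian R M]

/-- A module annihilated by the annihilator of `x` is a sum of quotients of `R ∙ x`. -/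
theorem boundsLength_torsionOf {e : Ordinal.{v}} (x : M)
    (hx : moduleLength R (Submodule.span R {x}) < ω ^ e) :
    BoundsLength e (Ideal.torsionOf R M x) := by
  intro Q _ _ _ h
  refine eq_top_of_smallPart (eq_top_iff.2 fun q _ => ?_)
  let g : Submodule.span R {x} →ₗ[R] Q :=
    ((Ideal.torsionOf R M x).liftQ (LinearMap.toSpanSingleton R Q q) fun r hr => by
      simpa using h r hr q) ∘ₗ (Ideal.quotTorsionOfEquivSpanSingleton R M x).symm.toLinearMap
  have hq : q ∈ LinearMap.range g :=
    ⟨Ideal.quotTorsionOfEquivSpanSingleton R M x (Submodule.Quotient.mk 1), by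
      simp only [g, LinearMap.comp_apply, LinearEquiv.coe_coe, LinearEquiv.symm_apply_apply]
      exact one_smul R q⟩
  exact le_smallPart ((moduleLength_le_of_surjective g.rangeRestrict
    g.surjective_rangeRestrict).trans_lt hx) hq

theorem exists_boundsLength_of_moduleLength_lt {e : Ordinal.{v}} (h : moduleLength R M < ω ^ e) :
    ∃ I : Ideal R, BoundsLength e I ∧ ∀ r ∈ I, ∀ x : M, r • x = 0 := by
  suffices H : ∀ N : Submodule R M,
      ∃ I : Ideal R, BoundsLength e I ∧ ∀ r ∈ I, ∀ x ∈ N, r • x = 0 by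
    obtain ⟨I, hI, hI'⟩ := H ⊤
    exact ⟨I, hI, fun r hr x => hI' r hr x trivial⟩
  intro N
  induction N, IsNoetherian.noetherian N using Submodule.fg_induction with
  | singleton x =>
    refine ⟨Ideal.torsionOf R M x, boundsLength_torsionOf x
      ((moduleLength_le_of_injective _ (Submodule.injective_subtype _)).trans_lt h), ?_⟩
    intro r hr y hy
    obtain ⟨s, rfl⟩ := Submodule.mem_span_singleton.1 hy
    rw [smul_comm, (Ideal.mem_torsionOf_iff x r).1 hr, smul_zero]
  | sup N₁ N₂ _ _ h₁ h₂ =>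
    obtain ⟨I₁, hI₁, hN₁⟩ := h₁
    obtain ⟨I₂, hI₂, hN₂⟩ := h₂
    refine ⟨I₁ * I₂, hI₁.mul hI₂, fun r hr x hx => ?_⟩
    obtain ⟨y, hy, z, hz, rfl⟩ := Submodule.mem_sup.1 hx
    have hr₁ : r ∈ I₁ := (Ideal.mul_le_inf hr).1
    have hr₂ : r ∈ I₂ := (Ideal.mul_le_inf hr).2
    rw [smul_add, hN₁ r hr₁ y hy, hN₂ r hr₂ z hz, add_zero]

/-- By the Artin–Rees lemma, `I ^ (k + 1) • M` meets the small part trivially when `I` annihilates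
the small part and `k` is large. -/
theorem exists_disjoint_smallPart [IsNoetherianRing R] (e : Ordinal.{v}) :
    ∃ L : Submodule R M, Disjoint L (smallPart R M e) ∧ moduleLength R (M ⧸ L) < ω ^ e := by
  obtain ⟨I, hI, hI0⟩ :=
    exists_boundsLength_of_moduleLength_lt (moduleLength_smallPart_lt (R := R) (M := M) e)
  obtain ⟨k, hk⟩ := Ideal.exists_pow_inf_eq_pow_smul I (smallPart R M e)
  refine ⟨I ^ (k + 1) • ⊤, ?_, hI.pow (k + 1) _ fun r hr q => ?_⟩
  · rw [disjoint_iff, hk (k + 1) (Nat.le_succ k), Nat.add_sub_cancel_left, pow_one, eq_bot_iff,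
      Submodule.smul_le]
    intro r hr x hx
    exact congrArg Subtype.val (hI0 r hr ⟨x, hx.2⟩)
  · obtain ⟨q, rfl⟩ := Submodule.mkQ_surjective _ q
    rw [← map_smul, Submodule.mkQ_apply, Submodule.Quotient.mk_eq_zero]
    exact Submodule.smul_mem_smul hr trivial

end Annihilator

/-! ### Submodules of prescribed length -/

theorem coeff_opow_mul_add_self {e r : Ordinal.{v}} (a : Ordinal.{v}) (hr : r < ω ^ e) :
    CNF.coeff ω (ω ^ e * a + r) e = a % ω := by
  have hpos : (ω : Ordinal.{v}) ^ e ≠ 0 := (opow_pos e omega0_pos).ne'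
  have hlt : ω ^ e * (a % ω) + r < ω ^ (e + 1) :=
    opow_mul_add_lt_opow (mod_lt a omega0_ne_zero) hr (lt_add_one e)
  have hdecomp : ω ^ e * a + r = ω ^ (e + 1) * (a / ω) + (ω ^ e * (a % ω) + r) := by
    conv_lhs => rw [← Ordinal.div_add_mod a ω]
    rw [mul_add, ← mul_assoc, opow_add, opow_one, add_assoc]
  rw [coeff_eq_mod_div one_lt_omega0, hdecomp, mul_add_mod_self, mod_eq_of_lt hlt,
    mul_add_div _ hpos, Ordinal.div_eq_zero_of_lt hr, add_zero]

section Realization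

variable {R : Type u} [CommRing R] {M : Type v} [AddCommGroup M] [Module R M] [IsNoetherian R M]

theorem smallPart_eq_bot_of_disjoint {e : Ordinal.{v}} {L : Submodule R M}
    (h : Disjoint L (smallPart R M e)) : smallPart R L e = ⊥ := by
  refine Submodule.map_injective_of_injective L.injective_subtype ?_
  rw [Submodule.map_bot, eq_bot_iff]
  exact h (Submodule.map_subtype_le L _) (map_smallPart_le e L.subtype)

/-- The part of exponent `e` of the length is realized by a submodule disjoint from the small
part. -/
theorem exists_disjoint_moduleLength_eq_opow_mul_coeff [IsNoetherianRing R] (e : Ordinal.{v}) :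
    ∃ L : Submodule R M, Disjoint L (smallPart R M e) ∧
      moduleLength R L = ω ^ e * CNF.coeff ω (moduleLength R M) e := by
  have hpos : (ω : Ordinal.{v}) ^ e ≠ 0 := (opow_pos e omega0_pos).ne'
  obtain ⟨L, hL, hq⟩ := exists_disjoint_smallPart (R := R) (M := M) e
  obtain ⟨a, ha⟩ := opow_dvd_moduleLength (smallPart_eq_bot_of_disjoint hL)
  -- `M` and `L` have the same coefficient of exponent `e`, as `M ⧸ L` is shorter than `ω ^ e`.
  have hle : moduleLength R L ≤ moduleLength R M :=
    moduleLength_le_of_injective _ L.injective_subtype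
  have hupper : moduleLength R M ≤ ω ^ e * a + moduleLength R (M ⧸ L) := by
    have := moduleLength_le_naturalAdd_quotient L
    rwa [ha, naturalAdd_comm, naturalAdd_opow_mul a hq] at this
  obtain ⟨r, hr⟩ := le_iff_exists_add.1 (ha ▸ hle)
  have hrlt : r < ω ^ e := by
    rw [hr, add_le_add_iff_left] at hupper
    exact hupper.trans_lt hq
  have hcoeff : CNF.coeff ω (moduleLength R M) e = a % ω := by
    rw [hr, coeff_opow_mul_add_self a hrlt]
  have hlen : moduleLength R (smallPart R L (e + 1)) = ω ^ e * (a % ω) := by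
    rw [← moduleLength_mod_opow, ha]
    conv_lhs => rw [← Ordinal.div_add_mod a ω]
    rw [mul_add, ← mul_assoc, opow_add, opow_one, mul_add_mod_self, mod_eq_of_lt]
    exact (mul_lt_mul_iff_right₀ (pos_iff_ne_zero.2 hpos)).2 (mod_lt a omega0_ne_zero)
  refine ⟨(smallPart R L (e + 1)).map L.subtype, hL.mono_left (Submodule.map_subtype_le L _), ?_⟩
  rw [moduleLength_map_eq _ L.injective_subtype, hlen, hcoeff]

/-- In a module of length `ω ^ e * c` with no nonzero submodule shorter than `ω ^ e`, the factor
of `ω ^ e` is additive, so the kernel of a quotient of length `ω ^ e * (c - k)` has length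
`ω ^ e * k`. -/
theorem exists_moduleLength_eq_opow_mul_natCast {e : Ordinal.{v}} {c k : ℕ} (hk : k ≤ c)
    (hM : smallPart R M e = ⊥) (hc : moduleLength R M = ω ^ e * c) :
    ∃ H : Submodule R M, moduleLength R H = ω ^ e * k := by
  have hpos : 0 < (ω : Ordinal.{v}) ^ e := opow_pos e omega0_pos
  obtain ⟨H, hH⟩ := exists_moduleLength_quotient_eq (R := R) (M := M)
    (o := ω ^ e * (c - k : ℕ)) (by
      rw [hc]
      exact mul_le_mul_right (Nat.cast_le.2 (Nat.sub_le c k)) _)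
  obtain ⟨b, hb⟩ := opow_dvd_moduleLength (M := H)
    (smallPart_eq_bot_of_disjoint (hM ▸ disjoint_bot_right))
  have h1 := moduleLength_quotient_add_le H
  have h2 := moduleLength_le_naturalAdd_quotient H
  rw [hH, hb, hc] at h1 h2
  rw [← mul_add, mul_le_mul_iff_right₀ hpos] at h1
  obtain ⟨b, rfl⟩ := lt_omega0.1 (le_add_self.trans_lt (h1.trans_lt (natCast_lt_omega0 c)))
  have h3 := h2.trans (naturalAdd_opow_mul_natCast_le _ _ _)
  rw [mul_le_mul_iff_right₀ hpos] at h3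
  norm_cast at h1 h3
  obtain rfl : b = k := by omega
  exact ⟨H, hb⟩

theorem exists_moduleLength_eq_of_weaker [IsNoetherianRing R] (n : Ordinal.{v})
    (hn : Weaker n (moduleLength R M)) : ∃ N : Submodule R M, moduleLength R N = n := by
  induction n using CNF.rec ω with
  | H0 => exact ⟨⊥, moduleLength_eq_zero_of_subsingleton⟩
  | H n hn0 ih =>
    set e := log ω n with he
    have hmod : n % ω ^ e < ω ^ e := mod_lt n (opow_pos e omega0_pos).ne'
    have hcoeff := CNF.coeff_opow_mul_add one_lt_omega0 (div_opow_log_pos ω hn0).ne'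
      (div_opow_log_lt n one_lt_omega0) hmod
    rw [← he, Ordinal.div_add_mod] at hcoeff
    obtain ⟨N, hN⟩ := ih fun d => le_trans (by simp [hcoeff]) (hn d)
    obtain ⟨L, hLdisj, hL⟩ :=
      exists_disjoint_moduleLength_eq_opow_mul_coeff (R := R) (M := M) e
    obtain ⟨k, hk⟩ := lt_omega0.1 (div_opow_log_lt n one_lt_omega0)
    obtain ⟨c, hc⟩ : ∃ c : ℕ, CNF.coeff ω (moduleLength R M) e = c := by
      rw [coeff_eq_mod_div one_lt_omega0]
      refine lt_omega0.1 ((Ordinal.lt_mul_iff_div_lt (opow_pos e omega0_pos).ne').1 ?_)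
      rw [← opow_succ]
      exact mod_lt _ (opow_pos _ omega0_pos).ne'
    have hkc : k ≤ c := by
      have := hn e
      rw [hcoeff, Finsupp.add_apply, Finsupp.single_eq_same, CNF.coeff_eq_zero_of_lt hmod,
        add_zero, hc, hk] at this
      exact_mod_cast this
    obtain ⟨H, hH⟩ := exists_moduleLength_eq_opow_mul_natCast hkc
      (smallPart_eq_bot_of_disjoint hLdisj) (hc ▸ hL)
    -- The submodule sought is the direct sum of `N` and the image of `H` in `M`.
    have hdisj : Disjoint (H.map L.subtype) N :=
      hLdisj.mono (Submodule.map_subtype_le L H) (le_smallPart (hN ▸ hmod))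
    let f : (H.map L.subtype × N) →ₗ[R] M :=
      (H.map L.subtype).subtype.coprod N.subtype
    have hf : Function.Injective f := by
      rw [← LinearMap.ker_eq_bot, LinearMap.ker_coprod_of_disjoint_range _ _ (by simpa)]
      simp
    have hlen : moduleLength R (H.map L.subtype) = ω ^ e * (n / ω ^ e) := by
      rw [moduleLength_map_eq _ L.injective_subtype, hH, hk]
    refine ⟨LinearMap.range f, ?_⟩
    rw [← moduleLength_congr (LinearEquiv.ofInjective f hf)]
    have h1 := moduleLength_add_le (LinearMap.inr R (H.map L.subtype) N)
      (LinearMap.fst R (H.map L.subtype) N) LinearMap.inr_injective LinearMap.fst_surjective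
      (LinearMap.range_inr R _ _).le
    have h2 := moduleLength_le_naturalAdd (LinearMap.inr R (H.map L.subtype) N)
      (LinearMap.fst R (H.map L.subtype) N) (LinearMap.range_inr R _ _).ge
    rw [hlen, hN] at h1 h2
    rw [naturalAdd_opow_mul _ hmod] at h2
    exact (h2.antisymm h1).trans (Ordinal.div_add_mod n _)

end Realization

end OrdLength

theorem mainTheorem4 (R : Type u) (M : Type v) [CommRing R] [IsNoetherianRing R]
    (hR : ringKrullDim R ≠ ⊤) [AddCommGroup M] [Module R M] [Module.Finite R M] :
    (∀ N : Submodule R M,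
      OrdLength.Weaker (OrdLength.moduleLength R N) (OrdLength.moduleLength R M)) ∧
    (∀ n : Ordinal.{v}, OrdLength.Weaker n (OrdLength.moduleLength R M) →
      ∃ N : Submodule R M, OrdLength.moduleLength R N = n) :=
  ⟨fun N => OrdLength.weaker_moduleLength_of_injective N.subtype N.injective_subtype,
    OrdLength.exists_moduleLength_eq_of_weaker⟩
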